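/- Let $n\in\mathbb N$ and let $M=\{(u_i,v_i)\}_{i=1}^m$ be a set of $m\ge 1$ pairs of elements of $\{0,1\}^n$ such that $u_1,v_1,\dots,u_m,v_m$ are all distinct; let $\cup M$ be the set of these $2m$ strings, and let $g:\{0,1\}^n\setminus\cup M\to\{0,1\}$ be arbitrary. Define $\varepsilon>0$ by $\varepsilon 2^n=m$. For a bipartition $M=A\sqcup B$ let $f^{(0)}_{A,B},f^{(1)}_{A,B}:\{0,1\}^n\to\{0,1\}$ both be equal to $g$ off $\cup M$, and put $$f^{(0)}_{A,B}(u)=f^{(0)}_{A,B}(v)=1,\quad f^{(1)}_{A,B}(u)=1,\ f^{(1)}_{A,B}(v)=0\qquad\text{for }(u,v)\in A,$$ $$f^{(0)}_{A,B}(u)=f^{(0)}_{A,B}(v)=0,\quad f^{(1)}_{A,B}(u)=0,\ f^{(1)}_{A,B}(v)=1\qquad\text{for }(u,v)\in B.$$ (The families $F_0=\{f^{(0)}_{A,B}\}$ and $F_1=\{f^{(1)}_{A,B}\}$ are the twin ensembles of $M$ and $g$.) For $f:\{0,1\}^n\to\{0,1\}$ let $|\Psi^{\mathrm{ph}}_f\rangle=2^{-n/2}\sum_x(-1)^{f(x)}|x\rangle$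 be its phase state and $|f\rangle=2^{-n/2}\sum_x|x,f(x)\rangle$ its function state. For $t\in\mathbb N$ and $k\in\{0,1\}$ put $$\rho^{\mathrm{ph}}_{k,t}=\mathbb E\left[\left(|\Psi^{\mathrm{ph}}_{f^{(k)}_{A,B}}\rangle\langle\Psi^{\mathrm{ph}}_{f^{(k)}_{A,B}}|\right)^{\otimes t}\right],\qquad \rho_{k,t}=\mathbb E\left[\left(|f^{(k)}_{A,B}\rangle\langle f^{(k)}_{A,B}|\right)^{\otimes t}\right],$$ where the expectations are over a uniformly random ordered bipartition $M=A\sqcup B$. Let $\|\cdot\|_1$ denote the trace norm (the sum of the singular values). **Theorem.** 1. For every $c>0$ there is $\delta=\delta(c)>0$ such that for all $n$, $M$, $g$ as above and all $t\in\mathbb N$ with $t\ge c/\varepsilon$, $$\|\rho^{\mathrm{ph}}_{0,t}-\rho^{\mathrm{ph}}_{1,t}\|_1\ge\delta\qquad\text{and}\qquad\|\rho_{0,t}-\rho_{1,t}\|_1\ge\delta .$$ 2. The twin ensembles can be distinguished from $O(1/\varepsilon)$ copies of the function state: there is an absolute constant $C>0$ such that for all $n$, $M$, $g$ as above and all $t\in\mathbb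 N$ with $t\ge C/\varepsilon$ there is a two-outcome measurement with accepting effect $0\le E\le 1$ on $t$ copies of the function state such that $\operatorname{tr}(E\rho_{0,t})\ge 2/3$ and $\operatorname{tr}(E\rho_{1,t})\le 1/3$. -/

import Mathlib

open scoped Matrix ComplexOrder

/-- The Boolean hypercube of `n`-bit strings. -/
abbrev Cube (n : ℕ) : Type := Fin n → Bool

/-! ### Twin ensembles -/

/-- The set of strings that occur in some pair of `M`. -/
def cover {n : ℕ} (M : Finset (Cube n × Cube n)) : Finset (Cube n) :=
  M.image Prod.fst ∪ M.image Prod.snd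

/-- `M = {(u₁, v₁), …, (uₘ, vₘ)}` with all of `u₁, v₁, …, uₘ, vₘ` distinct. -/
structure IsPairing {n : ℕ} (M : Finset (Cube n × Cube n)) : Prop where
  fst_inj : ∀ p ∈ M, ∀ q ∈ M, p.1 = q.1 → p = q
  snd_inj : ∀ p ∈ M, ∀ q ∈ M, p.2 = q.2 → p = q
  fst_ne_snd : ∀ p ∈ M, ∀ q ∈ M, p.1 ≠ q.2

/-- The function `f_{A,B}^{(0)}`, where `B = M \ A`: it is `1` on both elements of each pair in `A`,
`0` on both elements of each pair in `B`, and equal to `g` off the pairs. -/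
def twin0 {n : ℕ} (M : Finset (Cube n × Cube n)) (g : {x : Cube n // x ∉ cover M} → Bool)
    (A : Finset (Cube n × Cube n)) (x : Cube n) : Bool :=
  if h : x ∈ cover M then decide (∃ p ∈ A, x = p.1 ∨ x = p.2) else g ⟨x, h⟩

/-- The function `f_{A,B}^{(1)}`, where `B = M \ A`: it is `1` on `u` and `0` on `v` for each pair
`(u, v)` in `A`, `0` on `u` and `1` on `v` for each pair `(u, v)` in `B`, and equal to `g` off the
pairs. -/
def twin1 {n : ℕ} (M : Finset (Cube n × Cube n)) (g : {x : Cube n // x ∉ cover M} → Bool)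
    (A : Finset (Cube n × Cube n)) (x : Cube n) : Bool :=
  if h : x ∈ cover M then decide ((∃ p ∈ A, x = p.1) ∨ (∃ p ∈ M \ A, x = p.2)) else g ⟨x, h⟩

/-! ### Quantum states -/

/-- The phase state `2^{-n/2} ∑ₓ (-1)^{f(x)} |x⟩`, as a vector of amplitudes. -/
noncomputable def phaseState {n : ℕ} (f : Cube n → Bool) : Cube n → ℂ :=
  fun x => ((Real.sqrt (2 ^ n) : ℝ) : ℂ)⁻¹ * (-1) ^ (f x).toNat

/-- The function state `2^{-n/2} ∑ₓ |x, f(x)⟩` on `n + 1` qubits, as a vector of amplitudes. -/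
noncomputable def functionState {n : ℕ} (f : Cube n → Bool) : Cube n × Bool → ℂ :=
  fun z => ((Real.sqrt (2 ^ n) : ℝ) : ℂ)⁻¹ * (if z.2 = f z.1 then 1 else 0)

/-- The rank-one matrix `|ψ⟩⟨ψ|`. -/
def ketbra {X : Type*} (ψ : X → ℂ) : Matrix X X ℂ :=
  Matrix.vecMulVec ψ (star ψ)

/-- The `t`-fold tensor (Kronecker) power of a matrix, indexed by `t`-tuples. -/
def tensorPow {X : Type*} (t : ℕ) (P : Matrix X X ℂ) : Matrix (Fin t → X) (Fin t → X) ℂ :=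
  Matrix.of fun x y => ∏ j, P (x j) (y j)

/-- The average of `(|ψ_A⟩⟨ψ_A|)^{⊗ t}` over a uniformly random `A ⊆ M`, that is, over a uniformly
random ordered bipartition `M = A ⊔ B`. -/
noncomputable def averageState {X Y : Type*} (t : ℕ) (M : Finset Y) (ψ : Finset Y → X → ℂ) :
    Matrix (Fin t → X) (Fin t → X) ℂ :=
  ((2 : ℂ) ^ M.card)⁻¹ • ∑ A ∈ M.powerset, tensorPow t (ketbra (ψ A))

/-- The trace norm (Schatten `1`-norm) of a square complex matrix: the sum of its singular values,
which are the square roots of the eigenvalues of `Pᴴ * P`. -/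
noncomputable def traceNorm {X : Type*} [Fintype X] [DecidableEq X] (P : Matrix X X ℂ) : ℝ :=
  ∑ i, Real.sqrt ((Matrix.isHermitian_conjTranspose_mul_self P).eigenvalues i)

/-- An effect `0 ≤ E ≤ 1`, i.e. the accepting element of a two-outcome quantum measurement. -/
def IsEffect {X : Type*} [Fintype X] [DecidableEq X] (E : Matrix X X ℂ) : Prop :=
  E.PosSemidef ∧ (1 - E).PosSemidef

/-- The probability that the measurement with accepting effect `E` accepts the state `ρ`. -/
noncomputable def acceptProb {X : Type*} [Fintype X] (E ρ : Matrix X X ℂ) : ℝ :=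
  (E * ρ).trace.re

/-!
Call a pair `(u, v)` of basis vectors symmetric in a state `ψ` if `ψ u = ψ v`. The vectors
`(|u⟩ - |v⟩) / √2` with `(u, v) ∈ M` are orthonormal, and the test is to check that a state is
orthogonal to all of them. Every pair is symmetric in the states of the first ensemble, which
therefore always pass, while no pair is symmetric in those of the second, so each copy of a phase
state is caught with probability `2 * ε` and each copy of a function state (tested with `|u, b⟩` and
`|v, b⟩` for both `b`) with probability `ε`. All `t` copies of a state of the second ensemble hence
pass with probability at most `exp (-ε * t)`, whatever the bipartition. By Hölder's inequality
`|tr (E D)| ≤ ‖E‖ ‖D‖₁`, this gap in acceptance probabilities bounds the trace norm from below.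
-/

section TraceNorm

variable {X : Type*} [Fintype X] [DecidableEq X]

open scoped InnerProductSpace Matrix.Norms.L2Operator MatrixOrder

theorem trace_eq_sum_inner_toEuclideanCLM {𝕜 ι : Type*} [RCLike 𝕜] [Fintype ι]
    (A : Matrix X X 𝕜) (b : OrthonormalBasis ι 𝕜 (EuclideanSpace 𝕜 X)) :
    A.trace = ∑ i, ⟪b i, Matrix.toEuclideanCLM (𝕜 := 𝕜) A (b i)⟫_𝕜 := by
  rw [← Matrix.trace_toLin_eq A (EuclideanSpace.basisFun X 𝕜).toBasis,
    LinearMap.trace_eq_sum_inner _ b, ← Matrix.toEuclideanLin_eq_toLin_orthonormal]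
  rfl

theorem norm_toEuclideanCLM_eigenvectorBasis {𝕜 : Type*} [RCLike 𝕜] (A : Matrix X X 𝕜) (i : X) :
    ‖Matrix.toEuclideanCLM (𝕜 := 𝕜) A
        ((Matrix.isHermitian_conjTranspose_mul_self A).eigenvectorBasis i)‖ =
      √((Matrix.isHermitian_conjTranspose_mul_self A).eigenvalues i) := by
  rw [Matrix.IsHermitian.eigenvalues_eq, ← Matrix.mulVec_mulVec, Matrix.dotProduct_mulVec,
    ← Matrix.star_mulVec, ← Matrix.ofLp_toEuclideanCLM, dotProduct_comm,
    ← EuclideanSpace.inner_eq_star_dotProduct, ← norm_eq_sqrt_re_inner]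

theorem norm_trace_mul_le (A B : Matrix X X ℂ) : ‖(A * B).trace‖ ≤ ‖A‖ * traceNorm B := by
  set b := (Matrix.isHermitian_conjTranspose_mul_self B).eigenvectorBasis
  rw [trace_eq_sum_inner_toEuclideanCLM _ b, traceNorm, Finset.mul_sum]
  refine norm_sum_le_of_le _ fun i _ => ?_
  calc ‖⟪b i, Matrix.toEuclideanCLM (𝕜 := ℂ) (A * B) (b i)⟫_ℂ‖
      ≤ ‖b i‖ * ‖Matrix.toEuclideanCLM (𝕜 := ℂ) (A * B) (b i)‖ := norm_inner_le_norm _ _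
    _ = ‖Matrix.toEuclideanCLM (𝕜 := ℂ) A (Matrix.toEuclideanCLM (𝕜 := ℂ) B (b i))‖ := by
        rw [b.norm_eq_one, one_mul, map_mul, ContinuousLinearMap.mul_def,
          ContinuousLinearMap.comp_apply]
    _ ≤ ‖A‖ * ‖Matrix.toEuclideanCLM (𝕜 := ℂ) B (b i)‖ := ContinuousLinearMap.le_opNorm _ _
    _ = ‖A‖ * √((Matrix.isHermitian_conjTranspose_mul_self B).eigenvalues i) := by
        rw [norm_toEuclideanCLM_eigenvectorBasis]

theorem isEffect_of_isStarProjection {E : Matrix X X ℂ} (hE : IsStarProjection E) : IsEffect E :=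
  ⟨Matrix.nonneg_iff_posSemidef.mp hE.nonneg, Matrix.nonneg_iff_posSemidef.mp hE.one_sub_nonneg⟩

theorem IsEffect.norm_le_one {E : Matrix X X ℂ} (hE : IsEffect E) : ‖E‖ ≤ 1 :=
  (CStarAlgebra.norm_le_one_iff_of_nonneg E hE.1.nonneg).mpr (Matrix.le_iff.mpr hE.2)

theorem IsEffect.acceptProb_sub_le_traceNorm {E : Matrix X X ℂ} (hE : IsEffect E)
    (ρ σ : Matrix X X ℂ) : acceptProb E ρ - acceptProb E σ ≤ traceNorm (ρ - σ) := by
  have hnonneg : 0 ≤ traceNorm (ρ - σ) := Finset.sum_nonneg fun _ _ => Real.sqrt_nonneg _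
  calc acceptProb E ρ - acceptProb E σ = (E * (ρ - σ)).trace.re := by
        rw [acceptProb, acceptProb, Matrix.mul_sub, Matrix.trace_sub, Complex.sub_re]
    _ ≤ ‖(E * (ρ - σ)).trace‖ := Complex.re_le_norm _
    _ ≤ ‖E‖ * traceNorm (ρ - σ) := norm_trace_mul_le _ _
    _ ≤ traceNorm (ρ - σ) := mul_le_of_le_one_left hnonneg hE.norm_le_one

theorem IsEffect.one_sub_le_traceNorm {E ρ σ : Matrix X X ℂ} {q : ℝ} (hE : IsEffect E)
    (hρ : acceptProb E ρ = 1) (hσ : acceptProb E σ ≤ q) : 1 - q ≤ traceNorm (ρ - σ) :=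
  calc 1 - q ≤ acceptProb E ρ - acceptProb E σ := by rw [hρ]; exact sub_le_sub_left hσ 1
    _ ≤ traceNorm (ρ - σ) := hE.acceptProb_sub_le_traceNorm ρ σ

end TraceNorm

section TensorPow

variable {X : Type*} (t : ℕ)

theorem conjTranspose_tensorPow (P : Matrix X X ℂ) : (tensorPow t P)ᴴ = tensorPow t Pᴴ := by
  ext x y
  simp only [Matrix.conjTranspose_apply, tensorPow, Matrix.of_apply, star_prod]

variable [Fintype X]

theorem trace_tensorPow (P : Matrix X X ℂ) : (tensorPow t P).trace = P.trace ^ t := by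
  simp only [Matrix.trace, Matrix.diag_apply, tensorPow, Matrix.of_apply, Fintype.sum_pow]

theorem tensorPow_mul (P Q : Matrix X X ℂ) :
    tensorPow t (P * Q) = tensorPow t P * tensorPow t Q := by
  ext x y
  simp only [Matrix.mul_apply, tensorPow, Matrix.of_apply, ← Finset.prod_mul_distrib,
    Finset.prod_univ_sum, Fintype.piFinset_univ]

theorem isStarProjection_tensorPow {P : Matrix X X ℂ} (hP : IsStarProjection P) :
    IsStarProjection (tensorPow t P) where
  isIdempotentElem := by
    rw [IsIdempotentElem, ← tensorPow_mul, hP.isIdempotentElem.eq]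
  isSelfAdjoint := by
    rw [IsSelfAdjoint, Matrix.star_eq_conjTranspose, conjTranspose_tensorPow,
      ← Matrix.star_eq_conjTranspose, hP.isSelfAdjoint.star_eq]

theorem acceptProb_tensorPow_averageState {Y : Type*} {M : Finset Y} {ψ : Finset Y → X → ℂ}
    {P : Matrix X X ℂ} {q : ℝ} (hq : ∀ A ⊆ M, (P * ketbra (ψ A)).trace = q) :
    acceptProb (tensorPow t P) (averageState t M ψ) = q ^ t := by
  have htrace : ∀ A ∈ M.powerset,
      (tensorPow t P * tensorPow t (ketbra (ψ A))).trace = (q : ℂ) ^ t := fun A hA => by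
    rw [← tensorPow_mul, trace_tensorPow, hq A (Finset.mem_powerset.mp hA)]
  rw [acceptProb, averageState, Matrix.mul_smul, Matrix.trace_smul, Matrix.mul_sum,
    Matrix.trace_sum, Finset.sum_congr rfl htrace, Finset.sum_const, Finset.card_powerset,
    nsmul_eq_mul, smul_eq_mul, Nat.cast_pow, Nat.cast_ofNat, inv_mul_cancel_left₀ (by positivity),
    ← Complex.ofReal_pow, Complex.ofReal_re]

end TensorPow

section PairProjection

variable {X ι : Type*} [Fintype X]

theorem trace_mul_conjTranspose_mul_ketbra [Fintype ι] (V : Matrix X ι ℂ) (ψ : X → ℂ) :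
    (V * Vᴴ * ketbra ψ).trace = ((∑ i, ‖(Vᴴ *ᵥ ψ) i‖ ^ 2 : ℝ) : ℂ) := by
  have hstar : star ψ ᵥ* V = star (Vᴴ *ᵥ ψ) := by
    rw [Matrix.star_mulVec, Matrix.conjTranspose_conjTranspose]
  rw [Matrix.mul_assoc, Matrix.trace_mul_comm, ketbra, Matrix.mul_vecMulVec, Matrix.vecMulVec_mul,
    hstar, Matrix.trace_vecMulVec, dotProduct, Complex.ofReal_sum]
  exact Finset.sum_congr rfl fun i _ => (Complex.mul_conj' _).trans (by push_cast; rfl)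

variable [DecidableEq X] {a b : ι → X}

/-- The matrix whose `i`-th column is the vector `|a i⟩ - |b i⟩`. For `a` and `b` injective with
disjoint ranges it is `√2` times an isometry. -/
def pairDiff (a b : ι → X) : Matrix X ι ℂ :=
  (1 : Matrix X X ℂ).submatrix id a - (1 : Matrix X X ℂ).submatrix id b

theorem conjTranspose_pairDiff_mulVec (a b : ι → X) (ψ : X → ℂ) (i : ι) :
    ((pairDiff a b)ᴴ *ᵥ ψ) i = ψ (a i) - ψ (b i) := by
  simp [pairDiff, Matrix.mulVec, dotProduct, Matrix.one_apply, sub_mul]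

theorem conjTranspose_pairDiff_mul_pairDiff [DecidableEq ι] (ha : a.Injective) (hb : b.Injective)
    (hab : ∀ i j, a i ≠ b j) : (pairDiff a b)ᴴ * pairDiff a b = (2 : ℂ) • 1 := by
  ext i j
  change ((pairDiff a b)ᴴ *ᵥ fun x => pairDiff a b x j) i = _
  rw [conjTranspose_pairDiff_mulVec]
  simp only [pairDiff, Matrix.sub_apply, Matrix.submatrix_apply, id, Matrix.one_apply, ha.eq_iff,
    hb.eq_iff, hab, (hab _ _).symm, Matrix.smul_apply, if_false]
  split_ifs <;> norm_num

variable [Fintype ι]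

/-- For `a` and `b` injective with disjoint ranges, the orthogonal projection onto the vectors `ψ`
with `ψ (a i) = ψ (b i)` for all `i`. -/
noncomputable def pairProj (a b : ι → X) : Matrix X X ℂ :=
  1 - (2⁻¹ : ℂ) • (pairDiff a b * (pairDiff a b)ᴴ)

theorem isStarProjection_pairProj (ha : a.Injective) (hb : b.Injective)
    (hab : ∀ i j, a i ≠ b j) : IsStarProjection (pairProj a b) := by
  classical
  have hsq : pairDiff a b * (pairDiff a b)ᴴ * (pairDiff a b * (pairDiff a b)ᴴ) =
      (2 : ℂ) • (pairDiff a b * (pairDiff a b)ᴴ) := by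
    rw [Matrix.mul_assoc, ← Matrix.mul_assoc _ (pairDiff a b),
      conjTranspose_pairDiff_mul_pairDiff ha hb hab, Matrix.smul_mul, Matrix.one_mul,
      Matrix.mul_smul]
  refine IsStarProjection.one_sub ⟨?_, ?_⟩
  · rw [IsIdempotentElem, smul_mul_smul_comm, hsq, smul_smul]
    norm_num
  · rw [IsSelfAdjoint, Matrix.star_eq_conjTranspose, Matrix.conjTranspose_smul,
      (Matrix.isHermitian_mul_conjTranspose_self _).eq]
    simp

theorem trace_pairProj_mul_ketbra (a b : ι → X) (ψ : X → ℂ) :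
    (pairProj a b * ketbra ψ).trace =
      ((∑ x, ‖ψ x‖ ^ 2 - 2⁻¹ * ∑ i, ‖ψ (a i) - ψ (b i)‖ ^ 2 : ℝ) : ℂ) := by
  have hone := trace_mul_conjTranspose_mul_ketbra (1 : Matrix X X ℂ) ψ
  simp only [Matrix.conjTranspose_one, Matrix.one_mul, Matrix.one_mulVec] at hone
  have hdiff := trace_mul_conjTranspose_mul_ketbra (pairDiff a b) ψ
  simp only [conjTranspose_pairDiff_mulVec] at hdiff
  rw [pairProj, Matrix.sub_mul, Matrix.one_mul, Matrix.smul_mul, Matrix.trace_sub,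
    Matrix.trace_smul, hone, hdiff]
  push_cast
  rfl

end PairProjection

section States

variable {n : ℕ} {ι : Type*} [Fintype ι]

theorem norm_sq_inv_sqrt_two_pow (n : ℕ) : ‖((√(2 ^ n) : ℝ) : ℂ)⁻¹‖ ^ 2 = (2 ^ n)⁻¹ := by
  rw [norm_inv, Complex.norm_real, inv_pow, Real.norm_eq_abs, sq_abs, Real.sq_sqrt (by positivity)]

theorem norm_sq_phaseState_apply (f : Cube n → Bool) (x : Cube n) :
    ‖phaseState f x‖ ^ 2 = (2 ^ n)⁻¹ := by
  rw [phaseState, norm_mul, mul_pow, norm_sq_inv_sqrt_two_pow, norm_pow, norm_neg, norm_one,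
    one_pow, one_pow, mul_one]

theorem norm_sq_phaseState_sub (f : Cube n → Bool) (x y : Cube n) :
    ‖phaseState f x - phaseState f y‖ ^ 2 = if f x ≠ f y then 4 / 2 ^ n else 0 := by
  rw [phaseState, phaseState, ← mul_sub, norm_mul, mul_pow, norm_sq_inv_sqrt_two_pow]
  cases f x <;> cases f y <;> norm_num <;> ring

theorem sum_norm_sq_phaseState (f : Cube n → Bool) : ∑ x, ‖phaseState f x‖ ^ 2 = 1 := by
  simp [norm_sq_phaseState_apply]

theorem trace_pairProj_mul_ketbra_phaseState (a b : ι → Cube n) (f : Cube n → Bool) :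
    (pairProj a b * ketbra (phaseState f)).trace =
      ((1 - 2 * (Finset.card {i | f (a i) ≠ f (b i)} / 2 ^ n) : ℝ) : ℂ) := by
  simp only [trace_pairProj_mul_ketbra, sum_norm_sq_phaseState, norm_sq_phaseState_sub,
    ← Finset.sum_filter, Finset.sum_const, nsmul_eq_mul]
  congr 1
  ring

theorem sum_norm_sq_functionState_apply (f : Cube n → Bool) (x : Cube n) :
    ∑ b, ‖functionState f (x, b)‖ ^ 2 = (2 ^ n)⁻¹ := by
  simp only [Fintype.sum_bool, functionState, norm_mul, mul_pow, norm_sq_inv_sqrt_two_pow]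
  cases f x <;> simp

theorem sum_norm_sq_functionState_sub (f : Cube n → Bool) (x y : Cube n) :
    ∑ b, ‖functionState f (x, b) - functionState f (y, b)‖ ^ 2 =
      if f x ≠ f y then 2 / 2 ^ n else 0 := by
  simp only [Fintype.sum_bool, functionState, ← mul_sub, norm_mul, mul_pow,
    norm_sq_inv_sqrt_two_pow]
  cases f x <;> cases f y <;> norm_num <;> ring

theorem sum_norm_sq_functionState (f : Cube n → Bool) : ∑ z, ‖functionState f z‖ ^ 2 = 1 := by
  simp only [Fintype.sum_prod_type, sum_norm_sq_functionState_apply]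
  simp

theorem trace_pairProj_mul_ketbra_functionState (a b : ι → Cube n) (f : Cube n → Bool) :
    (pairProj (Prod.map a (id : Bool → Bool)) (Prod.map b id) * ketbra (functionState f)).trace =
      ((1 - Finset.card {i | f (a i) ≠ f (b i)} / 2 ^ n : ℝ) : ℂ) := by
  rw [trace_pairProj_mul_ketbra, sum_norm_sq_functionState, Fintype.sum_prod_type]
  simp only [Prod.map_apply, id, sum_norm_sq_functionState_sub,
    ← Finset.sum_filter, Finset.sum_const, nsmul_eq_mul]
  congr 1
  ring

end States

section Twins

variable {n : ℕ} {M A : Finset (Cube n × Cube n)} {g : {x : Cube n // x ∉ cover M} → Bool}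

theorem IsPairing.two_mul_card_le (hM : IsPairing M) : 2 * M.card ≤ 2 ^ n := by
  have hcard : (cover M).card = M.card + M.card := by
    rw [cover, Finset.card_union_of_disjoint, Finset.card_image_of_injOn hM.fst_inj,
      Finset.card_image_of_injOn hM.snd_inj]
    simp only [Finset.disjoint_left, Finset.mem_image]
    rintro _ ⟨p, hp, rfl⟩ ⟨q, hq, hqp⟩
    exact hM.fst_ne_snd p hp q hq hqp.symm
  calc 2 * M.card = (cover M).card := by rw [hcard, two_mul]
    _ ≤ Fintype.card (Cube n) := Finset.card_le_univ _
    _ = 2 ^ n := by simp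

theorem IsPairing.two_mul_card_div_two_pow_le_one (hM : IsPairing M) :
    2 * (M.card / 2 ^ n : ℝ) ≤ 1 := by
  rw [← mul_div_assoc, div_le_one (by positivity)]
  exact_mod_cast hM.two_mul_card_le

theorem IsPairing.injective_fst (hM : IsPairing M) :
    Function.Injective fun p : M => p.1.1 :=
  fun p q h => Subtype.ext (hM.fst_inj p p.2 q q.2 h)

theorem IsPairing.injective_snd (hM : IsPairing M) :
    Function.Injective fun p : M => p.1.2 :=
  fun p q h => Subtype.ext (hM.snd_inj p p.2 q q.2 h)

theorem twin0_fst (hM : IsPairing M) (hA : A ⊆ M) {p : Cube n × Cube n} (hp : p ∈ M) :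
    twin0 M g A p.1 = decide (p ∈ A) := by
  grind [twin0, cover, IsPairing]

theorem twin0_snd (hM : IsPairing M) (hA : A ⊆ M) {p : Cube n × Cube n} (hp : p ∈ M) :
    twin0 M g A p.2 = decide (p ∈ A) := by
  grind [twin0, cover, IsPairing]

theorem twin1_fst (hM : IsPairing M) (hA : A ⊆ M) {p : Cube n × Cube n} (hp : p ∈ M) :
    twin1 M g A p.1 = decide (p ∈ A) := by
  grind [twin1, cover, IsPairing]

theorem twin1_snd (hM : IsPairing M) (hA : A ⊆ M) {p : Cube n × Cube n} (hp : p ∈ M) :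
    twin1 M g A p.2 = decide (p ∉ A) := by
  grind [twin1, cover, IsPairing]

theorem card_twin0_fst_ne_snd (hM : IsPairing M) (hA : A ⊆ M) :
    Finset.card {p : M | twin0 M g A p.1.1 ≠ twin0 M g A p.1.2} = 0 := by
  simp [twin0_fst hM hA, twin0_snd hM hA]

theorem card_twin1_fst_ne_snd (hM : IsPairing M) (hA : A ⊆ M) :
    Finset.card {p : M | twin1 M g A p.1.1 ≠ twin1 M g A p.1.2} = M.card := by
  simp [twin1_fst hM hA, twin1_snd hM hA]

end Twins

section Distinguishing

theorem one_sub_pow_le_exp_neg {a c : ℝ} {t : ℕ} (ha : a ≤ 1) (hc : c ≤ a * t) :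
    (1 - a) ^ t ≤ Real.exp (-c) :=
  calc (1 - a) ^ t ≤ Real.exp (-a) ^ t :=
        pow_le_pow_left₀ (sub_nonneg.mpr ha) (Real.one_sub_le_exp_neg a) t
    _ = Real.exp (-(a * t)) := by rw [← Real.exp_nat_mul, mul_neg, mul_comm]
    _ ≤ Real.exp (-c) := Real.exp_le_exp.mpr (neg_le_neg hc)

variable {n : ℕ} {M : Finset (Cube n × Cube n)}

theorem exists_isEffect_phaseState (hM : IsPairing M) (g : {x : Cube n // x ∉ cover M} → Bool)
    (t : ℕ) :
    ∃ E, IsEffect E ∧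
      acceptProb E (averageState t M fun A => phaseState (twin0 M g A)) = 1 ∧
      acceptProb E (averageState t M fun A => phaseState (twin1 M g A)) =
        (1 - 2 * (M.card / 2 ^ n)) ^ t := by
  have hproj : IsStarProjection (pairProj (fun p : M => p.1.1) fun p => p.1.2) :=
    isStarProjection_pairProj hM.injective_fst hM.injective_snd
      fun p q => hM.fst_ne_snd p p.2 q q.2
  refine ⟨_, isEffect_of_isStarProjection (isStarProjection_tensorPow t hproj), ?_,
    acceptProb_tensorPow_averageState t fun A hA => ?_⟩
  · rw [acceptProb_tensorPow_averageState (q := 1) t fun A hA => ?_, one_pow]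
    rw [trace_pairProj_mul_ketbra_phaseState, card_twin0_fst_ne_snd hM hA, Nat.cast_zero, zero_div,
      mul_zero, sub_zero]
  · rw [trace_pairProj_mul_ketbra_phaseState, card_twin1_fst_ne_snd hM hA]

theorem exists_isEffect_functionState (hM : IsPairing M) (g : {x : Cube n // x ∉ cover M} → Bool)
    (t : ℕ) :
    ∃ E, IsEffect E ∧
      acceptProb E (averageState t M fun A => functionState (twin0 M g A)) = 1 ∧
      acceptProb E (averageState t M fun A => functionState (twin1 M g A)) =
        (1 - M.card / 2 ^ n) ^ t := by
  have hproj : IsStarProjection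
      (pairProj (Prod.map (fun p : M => p.1.1) (id : Bool → Bool))
        (Prod.map (fun p => p.1.2) id)) :=
    isStarProjection_pairProj (hM.injective_fst.prodMap Function.injective_id)
      (hM.injective_snd.prodMap Function.injective_id)
      fun p q h => hM.fst_ne_snd p.1 p.1.2 q.1 q.1.2 (congrArg Prod.fst h)
  refine ⟨_, isEffect_of_isStarProjection (isStarProjection_tensorPow t hproj), ?_,
    acceptProb_tensorPow_averageState t fun A hA => ?_⟩
  · rw [acceptProb_tensorPow_averageState (q := 1) t fun A hA => ?_, one_pow]
    rw [trace_pairProj_mul_ketbra_functionState, card_twin0_fst_ne_snd hM hA, Nat.cast_zero,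
      zero_div, sub_zero]
  · rw [trace_pairProj_mul_ketbra_functionState, card_twin1_fst_ne_snd hM hA]

end Distinguishing

theorem mainTheorem4 :
    (∀ c : ℝ, 0 < c → ∃ δ : ℝ, 0 < δ ∧
      ∀ (n : ℕ) (M : Finset (Cube n × Cube n)), IsPairing M →
      ∀ (g : {x : Cube n // x ∉ cover M} → Bool) (ε : ℝ), 0 < ε → ε * 2 ^ n = (M.card : ℝ) →
      ∀ t : ℕ, c / ε ≤ (t : ℝ) →
        δ ≤ traceNorm (averageState t M (fun A => phaseState (twin0 M g A)) -
              averageState t M (fun A => phaseState (twin1 M g A))) ∧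
        δ ≤ traceNorm (averageState t M (fun A => functionState (twin0 M g A)) -
              averageState t M (fun A => functionState (twin1 M g A)))) ∧
    (∃ C : ℝ, 0 < C ∧
      ∀ (n : ℕ) (M : Finset (Cube n × Cube n)), IsPairing M →
      ∀ (g : {x : Cube n // x ∉ cover M} → Bool) (ε : ℝ), 0 < ε → ε * 2 ^ n = (M.card : ℝ) →
      ∀ t : ℕ, C / ε ≤ (t : ℝ) →
        ∃ E : Matrix (Fin t → Cube n × Bool) (Fin t → Cube n × Bool) ℂ, IsEffect E ∧
          2 / 3 ≤ acceptProb E (averageState t M (fun A => functionState (twin0 M g A))) ∧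
          acceptProb E (averageState t M (fun A => functionState (twin1 M g A))) ≤ 1 / 3) := by
  refine ⟨fun c hc => ⟨1 - Real.exp (-c), by simpa using hc, ?_⟩, Real.log 3,
    Real.log_pos (by norm_num), ?_⟩
  all_goals
    intro n M hM g ε hε hεn t ht
    obtain rfl : ε = M.card / 2 ^ n := eq_div_of_mul_eq (by positivity) hεn
    rw [div_le_iff₀' hε] at ht
    have hε_le := hM.two_mul_card_div_two_pow_le_one
  · obtain ⟨E, hE, hE₀, hE₁⟩ := exists_isEffect_phaseState hM g t
    obtain ⟨F, hF, hF₀, hF₁⟩ := exists_isEffect_functionState hM g t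
    exact ⟨hE.one_sub_le_traceNorm hE₀
        (hE₁.trans_le (one_sub_pow_le_exp_neg hε_le (by linarith))),
      hF.one_sub_le_traceNorm hF₀ (hF₁.trans_le (one_sub_pow_le_exp_neg (by linarith) ht))⟩
  · obtain ⟨E, hE, hE₀, hE₁⟩ := exists_isEffect_functionState hM g t
    refine ⟨E, hE, by norm_num [hE₀], ?_⟩
    calc acceptProb E (averageState t M fun A => functionState (twin1 M g A))
        = (1 - M.card / 2 ^ n) ^ t := hE₁
      _ ≤ Real.exp (-Real.log 3) := one_sub_pow_le_exp_neg (by linarith) ht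
      _ = 1 / 3 := by rw [Real.exp_neg, Real.exp_log (by norm_num), one_div]
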